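/- Let $M\in\mathbb N$, let $\lambda_d,\beta,\alpha_u,d_0,P_d,P_u,\eta,B,C>0$, $N\ge 0$ and $\alpha_d>2$. Consider a device-to-device (D2D) receiver in the plane whose own transmitter is at distance $d_0$. The other D2D transmitters, located at points $(y_k)_{k}$, form a homogeneous Poisson point process on $\mathbb R^2$ of density $\lambda_d$; their locations are the same in all of the time slots $1,\dots,M$. Let $d_k$ be the distance from $y_k$ to the receiver. In slot $i$ an unmanned aerial vehicle (UAV) stops at altitude $h_i>0$, its projection on the ground being at distance $r_i\ge 0$ from the receiver; put $|X_{u,i}|=\sqrt{h_i^2+r_i^2}$, $\theta_i=\frac{180}{\pi}\sin^{-1}(h_i/|X_{u,i}|)$, $P_{\mathrm{LoS},i}=\frac{1}{1+C\exp(-B[\theta_i-C])}$ and $P_{\mathrm{NLoS},i}=1-P_{\mathrm{LoS},i}$. The UAV interference in slot $i$ is $I_{u,i}=P_u|X_{u,i}|^{-\alpha_u}$ with probability $P_{\mathrm{LoS},i}$ and $I_{u,i}=\eta P_u|X_{u,i}|^{-\alpha_u}$ with probability $P_{\mathrm{NLoS},i}$, independently over the slots. Under Rayleigh fading the channel gains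 $g_{0,i}$ (own transmitter) and $g_{k,i}$ (interferers) are i.i.d. exponential of mean $1$ over all links and all slots. The interferer locations, the channel gains and the UAV interference are independent. The SINR in slot $i$ is $$\gamma_{d,i}=\frac{P_d d_0^{-\alpha_d}g_{0,i}}{I^c_{d,i}+I_{u,i}+N},\qquad I^c_{d,i}=\sum_{k}P_d\, d_k^{-\alpha_d}g_{k,i},$$ and the overall outage probability is the probability of at least one failure in the $M$ transmissions, $P_{out,d}=1-\mathbb P[\gamma_{d,1}\ge\beta,\dots,\gamma_{d,M}\ge\beta]$. Then the integral below converges and $$P_{out,d}=1-\exp\Big(-\lambda_d\int_{\mathbb R^2}\Big[1-\Big(\frac{1}{1+\beta|x|^{-\alpha_d}/d_0^{-\alpha_d}}\Big)^{M}\Big]dx\Big)\;\prod_{i=1}^M\mathbb E\Big[\exp\Big(\frac{-d_0^{\alpha_d}\beta I_{u,i}}{P_d}\Big)\Big]\;\exp\Big(\frac{-d_0^{\alpha_d}\beta MN}{P_d}\Big),$$ where for every $i$ $$\mathbb E\Big[\exp\Big(\frac{-d_0^{\alpha_d}\beta I_{u,i}}{P_d}\Big)\Big]=P_{\mathrm{LoS},i}\exp\Big(\frac{-\beta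 d_0^{\alpha_d}P_u|X_{u,i}|^{-\alpha_u}}{P_d}\Big)+P_{\mathrm{NLoS},i}\exp\Big(\frac{-\beta d_0^{\alpha_d}\eta P_u|X_{u,i}|^{-\alpha_u}}{P_d}\Big).$$ -/

import Mathlib

open MeasureTheory ProbabilityTheory
open scoped ENNReal

/-- The ground plane `ℝ²` with its Euclidean norm. -/
abbrev Plane : Type := EuclideanSpace ℝ (Fin 2)

/-- The number of points of the enumerated random point configuration `X 0, X 1, …` that lie
in the set `S`. -/
noncomputable def pointCount {Ω E : Type*} (X : ℕ → Ω → E) (S : Set E) (ω : Ω) : ℕ∞ :=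
  {k : ℕ | X k ω ∈ S}.encard

/-- The random points `X 0, X 1, …` (listed in any measurable way) form a Poisson point process
with intensity measure `ν`: the number of points in a Borel set `S` of finite `ν`-measure is
Poisson distributed with mean `ν S`, and the numbers of points in disjoint sets are independent. -/
structure IsPoissonPointProcess {Ω E : Type*} [MeasurableSpace Ω] [MeasurableSpace E]
    (X : ℕ → Ω → E) (ν : Measure E) (P : Measure Ω) : Prop where
  measurable_point : ∀ k, Measurable (X k)
  hasLaw_count : ∀ S : Set E, MeasurableSet S → ν S ≠ ∞ →
    HasLaw (pointCount X S) ((poissonMeasure (ν S).toNNReal).map (Nat.cast : ℕ → ℕ∞)) P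
  indep_count : ∀ (n : ℕ) (S : Fin n → Set E), (∀ j, MeasurableSet (S j)) → (∀ j, ν (S j) ≠ ∞) →
    Pairwise (fun j l => Disjoint (S j) (S l)) → iIndepFun (fun j => pointCount X (S j)) P

/-- The deterministic parameters of the network over `M` transmission slots. -/
structure NetworkParams (M : ℕ) where
  /-- density of the D2D transmitters -/
  lam : ℝ
  /-- SINR threshold -/
  β : ℝ
  /-- path loss exponent of the D2D links -/
  αd : ℝ
  /-- path loss exponent of the links from the UAV -/
  αu : ℝ
  /-- distance between the transmitter and the receiver of the selected D2D pair -/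
  d₀ : ℝ
  /-- D2D transmit power -/
  Pd : ℝ
  /-- UAV transmit power -/
  Pu : ℝ
  /-- noise power -/
  N : ℝ
  /-- additional attenuation factor of a non-line-of-sight link -/
  η : ℝ
  /-- first environment constant of the line-of-sight probability -/
  B : ℝ
  /-- second environment constant of the line-of-sight probability -/
  C : ℝ
  /-- location of the receiver of the selected D2D pair -/
  rx : Plane
  /-- projection on the ground of the stop point of the UAV in each slot -/
  uavGround : Fin M → Plane
  /-- altitude of the stop point of the UAV in each slot -/
  alt : Fin M → ℝ
  lam_pos : 0 < lam
  β_pos : 0 < β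
  two_lt_αd : 2 < αd
  αu_pos : 0 < αu
  d₀_pos : 0 < d₀
  Pd_pos : 0 < Pd
  Pu_pos : 0 < Pu
  N_nonneg : 0 ≤ N
  η_pos : 0 < η
  B_pos : 0 < B
  C_pos : 0 < C
  alt_pos : ∀ i, 0 < alt i

namespace NetworkParams

variable {M : ℕ} (θ : NetworkParams M)

/-- Ground distance between the projection of the UAV and the receiver in slot `i`. -/
noncomputable def groundDist (i : Fin M) : ℝ := ‖θ.uavGround i - θ.rx‖

/-- Distance between the UAV and the receiver in slot `i`. -/
noncomputable def uavDist (i : Fin M) : ℝ := Real.sqrt (θ.alt i ^ 2 + θ.groundDist i ^ 2)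

/-- Elevation angle of the UAV, in degrees, seen from the receiver in slot `i`. -/
noncomputable def elevation (i : Fin M) : ℝ :=
  180 / Real.pi * Real.arcsin (θ.alt i / θ.uavDist i)

/-- Probability of a line-of-sight connection to the UAV in slot `i`. -/
noncomputable def probLoS (i : Fin M) : ℝ :=
  1 / (1 + θ.C * Real.exp (-θ.B * (θ.elevation i - θ.C)))

/-- Probability of a non-line-of-sight connection to the UAV in slot `i`. -/
noncomputable def probNLoS (i : Fin M) : ℝ := 1 - θ.probLoS i

end NetworkParams

/-- The random network on the probability space `(Ω, P)`. The interferer positions do not depend on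
the slot; the fading gains are independent across links and slots. -/
structure RandomNetwork {M : ℕ} (θ : NetworkParams M) {Ω : Type*} [MeasurableSpace Ω]
    (P : Measure Ω) where
  /-- positions of the interfering D2D transmitters -/
  pos : ℕ → Ω → Plane
  /-- `gain none i` is the channel gain of the selected D2D link in slot `i`, and
  `gain (some k) i` the gain from the `k`-th interferer to the selected receiver in slot `i` -/
  gain : Option ℕ → Fin M → Ω → ℝ
  /-- whether the receiver has a line-of-sight connection to the UAV in slot `i` -/
  los : Fin M → Ω → Bool
  poisson_pos : IsPoissonPointProcess pos (ENNReal.ofReal θ.lam • (volume : Measure Plane)) P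
  measurable_gain : ∀ k i, Measurable (gain k i)
  /-- Rayleigh fading: the power gains are exponential with mean one -/
  hasLaw_gain : ∀ k i, HasLaw (gain k i) (expMeasure 1) P
  iIndep_gain : iIndepFun (fun (p : Option ℕ × Fin M) => gain p.1 p.2) P
  measurable_los : ∀ i, Measurable (los i)
  prob_los : ∀ i, P {ω | los i ω = true} = ENNReal.ofReal (θ.probLoS i)
  iIndep_los : iIndepFun los P
  indep_pos_gain : IndepFun (fun ω (k : ℕ) => pos k ω)
    (fun ω (p : Option ℕ × Fin M) => gain p.1 p.2 ω) P
  indep_ground_los : IndepFun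
    (fun ω => ((fun k : ℕ => pos k ω), (fun p : Option ℕ × Fin M => gain p.1 p.2 ω)))
    (fun ω (i : Fin M) => los i ω) P

namespace RandomNetwork

variable {M : ℕ} {θ : NetworkParams M} {Ω : Type*} [MeasurableSpace Ω] {P : Measure Ω}
  (net : RandomNetwork θ P)

/-- Received power from the transmitter of the selected D2D pair in slot `i`. -/
noncomputable def signal (i : Fin M) (ω : Ω) : ℝ :=
  θ.Pd * θ.d₀ ^ (-θ.αd) * net.gain none i ω

/-- Total interference from the other D2D transmitters in slot `i`, a sum in `[0, ∞]`. -/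
noncomputable def d2dInterference (i : Fin M) (ω : Ω) : ℝ≥0∞ :=
  ∑' k : ℕ, ENNReal.ofReal (θ.Pd * ‖net.pos k ω - θ.rx‖ ^ (-θ.αd) * net.gain (some k) i ω)

/-- Interference from the UAV in slot `i`. -/
noncomputable def uavInterference (i : Fin M) (ω : Ω) : ℝ :=
  if net.los i ω = true then θ.Pu * θ.uavDist i ^ (-θ.αu)
  else θ.η * θ.Pu * θ.uavDist i ^ (-θ.αu)

/-- Signal to interference plus noise ratio at the selected D2D receiver in slot `i`. -/
noncomputable def sinr (i : Fin M) (ω : Ω) : ℝ≥0∞ :=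
  ENNReal.ofReal (net.signal i ω) /
    (net.d2dInterference i ω + ENNReal.ofReal (net.uavInterference i ω) + ENNReal.ofReal θ.N)

/-- Overall outage probability: the probability that at least one of the `M` transmissions fails,
a transmission being successful when its SINR is at least `β`. -/
noncomputable def outageProb : ℝ :=
  P.real {ω | ∃ i : Fin M, ¬ ENNReal.ofReal θ.β ≤ net.sinr i ω}

end RandomNetwork

/-!
Write `g₀ᵢ` for the gain of the selected link in slot `i`. The transmission in slot `i` succeeds
exactly when `g₀ᵢ` exceeds a load which is the sum of a deterministic function of the line-of-sight
indicator (UAV interference and noise) and of `∑ₖ aₖ gₖᵢ`, where `aₖ` depends only on the position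
of the `k`-th interferer (`RandomNetwork.le_sinr_iff`).

Given the positions and the line-of-sight indicators, exponential tails turn the probability of
success in all slots into the Laplace transform of the total load, and the exponential gains `gₖᵢ`
turn the latter into `∏ₖ (1 + aₖ)⁻ᴹ` times a factor for the UAV and the noise
(`measure_forall_add_tsum_le_exponential`). The power `M` appears because the positions are shared
by all slots. The infinite product is written as `exp (-∑ₖ M log (1 + aₖ))`, so averaging over the
positions is an instance of the Laplace functional of a Poisson point process,
`E exp (-∑ₖ f (Xₖ)) = exp (-∫ (1 - e⁻ᶠ) dν)` (`IsPoissonPointProcess.lintegral_expNeg_tsum`), which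
is proved here from the independent Poisson counts by monotone approximation with simple functions.
Averaging over the independent line-of-sight indicators gives the remaining product.

The total interference may be infinite, so these computations use `expNeg t = exp (-t)` on `[0, ∞]`
and lower Lebesgue integrals. The integral in the exponent converges because its integrand is at
most `1` near the origin and `O(‖x‖ ^ (-αd))` with `αd > 2` at infinity.
-/

open Filter Topology

/-! ### The function `exp (-t)` on `[0, ∞]` -/

/-- The function `t ↦ exp (-t)` on `[0, ∞]`, with `exp (-∞) = 0`. -/
noncomputable def expNeg (t : ℝ≥0∞) : ℝ≥0∞ := EReal.exp (-(t : EReal))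

@[simp] lemma expNeg_zero : expNeg 0 = 1 := by simp [expNeg]

@[simp] lemma expNeg_top : expNeg ∞ = 0 := by simp [expNeg]

lemma expNeg_ofReal {x : ℝ} (hx : 0 ≤ x) :
    expNeg (ENNReal.ofReal x) = ENNReal.ofReal (Real.exp (-x)) := by
  rw [expNeg, EReal.coe_ennreal_ofReal, max_eq_left hx, ← EReal.coe_neg, EReal.exp_coe]

lemma expNeg_add (a b : ℝ≥0∞) : expNeg (a + b) = expNeg a * expNeg b := by
  rw [expNeg, EReal.coe_ennreal_add, EReal.neg_add (by simp) (by simp), sub_eq_add_neg,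
    EReal.exp_add, expNeg, expNeg]

lemma expNeg_sum {ι : Type*} (s : Finset ι) (f : ι → ℝ≥0∞) :
    expNeg (∑ i ∈ s, f i) = ∏ i ∈ s, expNeg (f i) := by
  classical
  induction s using Finset.induction_on with
  | empty => simp
  | insert a s ha ih => rw [Finset.sum_insert ha, Finset.prod_insert ha, expNeg_add, ih]

lemma expNeg_antitone : Antitone expNeg := fun _ _ h =>
  EReal.exp_monotone (EReal.neg_le_neg_iff.2 (EReal.coe_ennreal_le_coe_ennreal_iff.2 h))

lemma expNeg_le_one (t : ℝ≥0∞) : expNeg t ≤ 1 := by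
  simpa using expNeg_antitone (zero_le (a := t))

lemma expNeg_ne_top (t : ℝ≥0∞) : expNeg t ≠ ∞ := ne_top_of_le_ne_top (by simp) (expNeg_le_one t)

lemma continuous_expNeg : Continuous expNeg :=
  ENNReal.continuous_exp.comp (continuous_neg.comp continuous_coe_ennreal_ereal)

@[fun_prop]
lemma measurable_expNeg : Measurable expNeg := continuous_expNeg.measurable

/-! ### Exponential and Poisson distributions -/

/-- The tail of the exponential distribution of mean one. -/
lemma expMeasure_one_tail (t : ℝ≥0∞) :
    expMeasure 1 {y | t ≤ ENNReal.ofReal y} = expNeg t := by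
  have : IsProbabilityMeasure (expMeasure 1) := isProbabilityMeasure_expMeasure one_pos
  induction t with
  | top => simp
  | coe r =>
    rcases eq_or_ne r 0 with rfl | hr
    · simp
    have hset : {y : ℝ | (r : ℝ≥0∞) ≤ ENNReal.ofReal y} = Set.Ici (r : ℝ) := by
      ext y
      rw [Set.mem_ofPred_eq, Set.mem_Ici, ← ENNReal.ofReal_coe_nnreal,
        ENNReal.ofReal_le_ofReal_iff', or_iff_left]
      exact fun h => hr (NNReal.coe_eq_zero.1 (le_antisymm h r.coe_nonneg))
    have hac : expMeasure 1 ≪ volume := withDensity_absolutelyContinuous _ _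
    have hIci : expMeasure 1 (Set.Ici (r : ℝ)) = expMeasure 1 (Set.Ioi (r : ℝ)) :=
      measure_congr (hac.ae_eq Ioi_ae_eq_Ici).symm
    rw [hset, hIci, ← Set.compl_Iic, prob_compl_eq_one_sub measurableSet_Iic, ← ofReal_cdf,
      cdf_expMeasure_eq one_pos, if_pos r.coe_nonneg, ← ENNReal.ofReal_one,
      ← ENNReal.ofReal_sub _ (by simp), ← ENNReal.ofReal_coe_nnreal, expNeg_ofReal r.coe_nonneg]
    simp

/-- The Laplace transform of the exponential distribution of mean one. -/
lemma lintegral_expNeg_expMeasure_one {t : ℝ} (ht : 0 ≤ t) :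
    ∫⁻ y, expNeg (ENNReal.ofReal (t * y)) ∂expMeasure 1
      = expNeg (ENNReal.ofReal (Real.log (1 + t))) := by
  have h1 : (0 : ℝ) < 1 + t := by linarith
  have hm : expMeasure 1 = volume.withDensity (exponentialPDF 1) := rfl
  have hpdf : ∀ r, Measurable (exponentialPDF r) := fun r =>
    (measurable_exponentialPDFReal r).ennreal_ofReal
  -- Tilting the density of rate `1` by `exp (-t y)` gives `(1 + t)⁻¹` times that of rate `1 + t`.
  have key : ∀ y, exponentialPDF 1 y * expNeg (ENNReal.ofReal (t * y))
      = ENNReal.ofReal (1 + t)⁻¹ * exponentialPDF (1 + t) y := by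
    intro y
    rcases lt_or_ge y 0 with hy | hy
    · simp [exponentialPDF_of_neg hy]
    · rw [exponentialPDF_of_nonneg hy, exponentialPDF_of_nonneg hy,
        expNeg_ofReal (mul_nonneg ht hy), ← ENNReal.ofReal_mul (by positivity),
        ← ENNReal.ofReal_mul (by positivity), ← mul_assoc, inv_mul_cancel₀ h1.ne', one_mul, one_mul,
        one_mul, ← Real.exp_add]
      ring_nf
  rw [hm, lintegral_withDensity_eq_lintegral_mul _ (hpdf 1) (by fun_prop)]
  simp only [Pi.mul_apply, key]
  rw [lintegral_const_mul _ (hpdf _), lintegral_exponentialPDF_eq_one h1, mul_one,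
    expNeg_ofReal (Real.log_nonneg (by linarith)), Real.exp_neg, Real.exp_log h1]

/-- The Laplace transform of the Poisson distribution. -/
lemma lintegral_expNeg_mul_poisson (r : NNReal) {c : ℝ≥0∞} (hc : c ≠ ∞) :
    ∫⁻ n : ℕ∞, expNeg (c * n) ∂((poissonMeasure r).map (Nat.cast : ℕ → ℕ∞))
      = expNeg ((1 - expNeg c) * r) := by
  lift c to NNReal using hc
  have hq : expNeg c = ENNReal.ofReal (Real.exp (-c)) := by
    rw [← expNeg_ofReal c.coe_nonneg, ENNReal.ofReal_coe_nnreal]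
  have hle : Real.exp (-c) ≤ 1 := by simp
  have hn : ∀ n : ℕ, expNeg (c * n) = ENNReal.ofReal (Real.exp (-c) ^ n) := by
    intro n
    rw [← Real.exp_nat_mul, mul_neg, ← expNeg_ofReal (by positivity), ENNReal.ofReal_mul (by simp)]
    simp [mul_comm]
  have hsum : HasSum (fun n : ℕ => Real.exp (-r) * r ^ n / (n.factorial : ℝ) * Real.exp (-c) ^ n)
      (Real.exp (-r) * Real.exp (r * Real.exp (-c))) := by
    convert! (NormedSpace.expSeries_div_hasSum_exp ((r : ℝ) * Real.exp (-c))).mul_left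
      (Real.exp (-r)) using 1
    · ext n
      rw [mul_pow]
      ring
    · simp [← Real.exp_eq_exp_ℝ]
  rw [lintegral_map (by fun_prop) (by fun_prop), poissonMeasure, lintegral_sum_measure]
  simp only [lintegral_smul_measure, lintegral_dirac, ENat.toENNReal_coe, hn, smul_eq_mul]
  rw [tsum_congr fun n => (ENNReal.ofReal_mul (by positivity)).symm,
    ← ENNReal.ofReal_tsum_of_nonneg (fun n => by positivity) hsum.summable, hsum.tsum_eq, hq,
    ← ENNReal.ofReal_one, ← ENNReal.ofReal_sub _ (by positivity), ← ENNReal.ofReal_coe_nnreal,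
    ← ENNReal.ofReal_mul (by linarith), expNeg_ofReal (mul_nonneg (by linarith) r.coe_nonneg),
    ← Real.exp_add]
  ring_nf

/-! ### The Laplace functional of a Poisson point process -/

/-- The number of points in a set as a sum of indicators over all points. -/
lemma tsum_indicator_eq_pointCount {Ω E : Type*} (X : ℕ → Ω → E) (S : Set E) (ω : Ω) :
    ∑' k, S.indicator (fun _ => (1 : ℝ≥0∞)) (X k ω) = pointCount X S ω := by
  rw [pointCount, ← ENNReal.tsum_set_one, tsum_subtype {k | X k ω ∈ S} (fun _ => (1 : ℝ≥0∞))]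
  rfl

/-- A sum over the points of a simple function is a finite combination of numbers of points. -/
lemma tsum_simpleFunc_eq {Ω E : Type*} [MeasurableSpace E] (X : ℕ → Ω → E)
    (g : SimpleFunc E ℝ≥0∞) (ω : Ω) :
    ∑' k, g (X k ω)
      = ∑ c ∈ g.range.filter (· ≠ 0), c * (pointCount X (g ⁻¹' {c}) ω : ℝ≥0∞) := by
  have h : ∀ x, g x = ∑ c ∈ g.range.filter (· ≠ 0),
      c * (g ⁻¹' {c}).indicator (fun _ => (1 : ℝ≥0∞)) x := by
    intro x
    classical
    simp only [Set.indicator_apply, Set.mem_preimage, Set.mem_singleton_iff, mul_ite, mul_one,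
      mul_zero, Finset.sum_ite_eq, Finset.mem_filter, SimpleFunc.mem_range_self, true_and]
    split_ifs with h0
    · rfl
    · simpa using h0
  simp only [← tsum_indicator_eq_pointCount, ← ENNReal.tsum_mul_left]
  rw [← Summable.tsum_finsetSum fun _ _ => ENNReal.summable]
  exact tsum_congr fun k => h _

namespace IsPoissonPointProcess

variable {Ω E : Type*} [MeasurableSpace Ω] [MeasurableSpace E] {X : ℕ → Ω → E} {ν : Measure E}
  {P : Measure Ω}

/-- The Laplace functional of a Poisson point process at a simple function, whose level sets carry
independent Poisson numbers of points. -/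
lemma lintegral_expNeg_tsum_simpleFunc (hX : IsPoissonPointProcess X ν P) (g : SimpleFunc E ℝ≥0∞)
    (hfin : ∀ c ≠ 0, ν (g ⁻¹' {c}) ≠ ∞) (htop : ∀ x, g x ≠ ∞) :
    ∫⁻ ω, expNeg (∑' k, g (X k ω)) ∂P = expNeg (∫⁻ x, (1 - expNeg (g x)) ∂ν) := by
  set s := g.range.filter (· ≠ 0) with hs
  let e := s.equivFin.symm
  let c : Fin s.card → ℝ≥0∞ := fun j => e j
  have hc0 : ∀ j, c j ≠ 0 := fun j => (Finset.mem_filter.1 (e j).2).2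
  have hctop : ∀ j, c j ≠ ∞ := fun j => by
    obtain ⟨x, hx⟩ := SimpleFunc.mem_range.1 (Finset.mem_filter.1 (e j).2).1
    exact fun h => htop x (hx.trans h)
  have hcinj : Function.Injective c := Subtype.val_injective.comp e.injective
  have hreindex : ∀ F : ℝ≥0∞ → ℝ≥0∞, ∑ a ∈ s, F a = ∑ j, F (c j) := fun F => by
    rw [← Finset.sum_coe_sort s F, ← e.sum_comp]
  have hmeas : ∀ j, MeasurableSet (g ⁻¹' {c j}) := fun j => g.measurableSet_fiber _
  have hindep := hX.indep_count s.card (fun j => g ⁻¹' {c j}) hmeas (fun j => hfin _ (hc0 j))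
    (fun j l hjl => Disjoint.preimage _ (by simpa using hcinj.ne hjl))
  have hY := hindep.comp (fun j (n : ℕ∞) => expNeg (c j * n)) (fun j => Measurable.of_discrete)
  have hYm : ∀ j, Measurable ((fun n : ℕ∞ => expNeg (c j * n)) ∘ pointCount X (g ⁻¹' {c j})) := by
    intro j
    have : ((fun n : ℕ∞ => expNeg (c j * n)) ∘ pointCount X (g ⁻¹' {c j})) = fun ω =>
        expNeg (c j * ∑' k, (g ⁻¹' {c j}).indicator (fun _ => (1 : ℝ≥0∞)) (X k ω)) := by
      ext ω
      simp only [Function.comp_apply, tsum_indicator_eq_pointCount]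
    rw [this]
    refine measurable_expNeg.comp (Measurable.const_mul (Measurable.tsum fun k => ?_) _)
    exact (measurable_const.indicator (hmeas j)).comp (hX.measurable_point k)
  have hlap : ∀ j, ∫⁻ ω, expNeg (c j * (pointCount X (g ⁻¹' {c j}) ω : ℝ≥0∞)) ∂P
      = expNeg ((1 - expNeg (c j)) * ν (g ⁻¹' {c j})) := by
    intro j
    rw [(hX.hasLaw_count _ (hmeas j) (hfin _ (hc0 j))).lintegral_comp
      (f := fun n : ℕ∞ => expNeg (c j * n)) (by fun_prop),
      lintegral_expNeg_mul_poisson _ (hctop j), ENNReal.coe_toNNReal (hfin _ (hc0 j))]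
  have hR : ∫⁻ x, (1 - expNeg (g x)) ∂ν = ∑ a ∈ s, (1 - expNeg a) * ν (g ⁻¹' {a}) := by
    have := SimpleFunc.map_lintegral (μ := ν) (fun a => 1 - expNeg a) g
    rw [← SimpleFunc.lintegral_eq_lintegral] at this
    simp only [SimpleFunc.coe_map, Function.comp_apply] at this
    rw [this, hs, Finset.sum_filter]
    refine Finset.sum_congr rfl fun a _ => ?_
    split_ifs with h
    · rfl
    · simp [not_not.1 h]
  have hL : ∀ ω, expNeg (∑' k, g (X k ω))
      = ∏ j, ((fun n : ℕ∞ => expNeg (c j * n)) ∘ pointCount X (g ⁻¹' {c j})) ω := by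
    intro ω
    rw [tsum_simpleFunc_eq, hreindex fun a => a * (pointCount X (g ⁻¹' {a}) ω : ℝ≥0∞), expNeg_sum]
    rfl
  simp_rw [hL]
  rw [lintegral_prod_eq_prod_lintegral_of_indepFun _ _ hY hYm, hR,
    hreindex fun a => (1 - expNeg a) * ν (g ⁻¹' {a}), expNeg_sum]
  exact Finset.prod_congr rfl fun j _ => hlap j

/-- The Laplace functional of a Poisson point process: `E exp (-∑ₖ f (Xₖ)) = exp (-∫ (1 - e⁻ᶠ) dν)`
for every measurable `f ≥ 0`. It follows from the case of simple functions by monotone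
approximation. -/
theorem lintegral_expNeg_tsum [IsProbabilityMeasure P] [SigmaFinite ν]
    (hX : IsPoissonPointProcess X ν P) {f : E → ℝ≥0∞} (hf : Measurable f) :
    ∫⁻ ω, expNeg (∑' k, f (X k ω)) ∂P = expNeg (∫⁻ x, (1 - expNeg (f x)) ∂ν) := by
  let g : ℕ → SimpleFunc E ℝ≥0∞ := fun n => (SimpleFunc.eapprox f n).restrict (spanningSets ν n)
  have hg : ∀ n x, g n x = (spanningSets ν n).indicator (SimpleFunc.eapprox f n) x := fun n x => by
    simp only [g, SimpleFunc.restrict_apply _ (measurableSet_spanningSets ν n)]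
  have hmono : ∀ x, Monotone fun n => g n x := by
    intro x n m hnm
    simp only [hg]
    exact (Set.indicator_le_indicator (SimpleFunc.monotone_eapprox f hnm x)).trans
      (Set.indicator_le_indicator_of_subset (monotone_spanningSets ν hnm) (fun _ => zero_le) x)
  have hlim : ∀ x, Tendsto (fun n => g n x) atTop (𝓝 (f x)) := by
    intro x
    refine (SimpleFunc.tendsto_eapprox hf x).congr' ?_
    filter_upwards [eventually_ge_atTop (spanningSetsIndex ν x)] with n hn
    rw [hg, Set.indicator_of_mem (mem_spanningSets_of_index_le ν x hn)]
  have hsimple : ∀ n, ∫⁻ ω, expNeg (∑' k, g n (X k ω)) ∂P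
      = expNeg (∫⁻ x, (1 - expNeg (g n x)) ∂ν) := by
    intro n
    refine hX.lintegral_expNeg_tsum_simpleFunc (g n) (fun c hc => ?_) (fun x => ?_)
    · refine ((measure_mono fun x hx => ?_).trans_lt (measure_spanningSets_lt_top ν n)).ne
      by_contra hxs
      rw [Set.mem_preimage, Set.mem_singleton_iff, hg, Set.indicator_of_notMem hxs] at hx
      exact hc hx.symm
    · rw [hg]
      exact ((Set.indicator_le_self _ _ x).trans_lt (SimpleFunc.eapprox_lt_top f n x)).ne
  have hsum : ∀ ω, Tendsto (fun n => ∑' k, g n (X k ω)) atTop (𝓝 (∑' k, f (X k ω))) := by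
    intro ω
    simp_rw [← lintegral_count]
    exact lintegral_tendsto_of_tendsto_of_monotone (fun n => Measurable.of_discrete.aemeasurable)
      (ae_of_all _ fun k => hmono (X k ω)) (ae_of_all _ fun k => hlim (X k ω))
  have hL : Tendsto (fun n => ∫⁻ ω, expNeg (∑' k, g n (X k ω)) ∂P) atTop
      (𝓝 (∫⁻ ω, expNeg (∑' k, f (X k ω)) ∂P)) := by
    refine tendsto_lintegral_of_dominated_convergence (fun _ => 1) (fun n => ?_)
      (fun n => ae_of_all _ fun ω => expNeg_le_one _) (by simp)
      (ae_of_all _ fun ω => (continuous_expNeg.tendsto _).comp (hsum ω))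
    exact measurable_expNeg.comp
      (Measurable.tsum fun k => (g n).measurable.comp (hX.measurable_point k))
  have hcont : Continuous fun t : ℝ≥0∞ => 1 - expNeg t :=
    (ENNReal.continuous_sub_left ENNReal.one_ne_top).comp continuous_expNeg
  have hR : Tendsto (fun n => ∫⁻ x, (1 - expNeg (g n x)) ∂ν) atTop
      (𝓝 (∫⁻ x, (1 - expNeg (f x)) ∂ν)) :=
    lintegral_tendsto_of_tendsto_of_monotone
      (fun n => (hcont.measurable.comp (g n).measurable).aemeasurable)
      (ae_of_all _ fun x n m hnm => tsub_le_tsub_left (expNeg_antitone (hmono x hnm)) 1)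
      (ae_of_all _ fun x => (hcont.tendsto _).comp (hlim x))
  refine tendsto_nhds_unique hL ?_
  simp_rw [hsimple]
  exact (continuous_expNeg.tendsto _).comp hR

end IsPoissonPointProcess

/-! ### Exponential fading -/

section Fading

lemma comap_subfamily_le {Ω ι κ β : Type*} [MeasurableSpace β] (G : ι → Ω → β) (u : κ → ι) :
    MeasurableSpace.comap (fun ω a => G (u a) ω) MeasurableSpace.pi
      ≤ ⨆ i ∈ Set.range u, MeasurableSpace.comap (G i) inferInstance := by
  rw [MeasurableSpace.pi, MeasurableSpace.comap_iSup]
  refine iSup_le fun a => ?_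
  rw [MeasurableSpace.comap_comp]
  exact le_iSup₂_of_le (u a) (Set.mem_range_self a) le_rfl

variable {Ω : Type*} [MeasurableSpace Ω] {P : Measure Ω}

/-- Conditioning on the first of two independent random elements. -/
lemma measure_mem_eq_lintegral_of_indepFun [IsProbabilityMeasure P] {A B : Type*}
    [MeasurableSpace A] [MeasurableSpace B] {X : Ω → A} {Y : Ω → B} (hX : Measurable X)
    (hY : Measurable Y) (h : IndepFun X Y P) {S : Set (A × B)} (hS : MeasurableSet S) :
    P {ω | (X ω, Y ω) ∈ S} = ∫⁻ ω, P {ω' | (X ω, Y ω') ∈ S} ∂P := by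
  have hmap := (indepFun_iff_map_prod_eq_prod_map_map hX.aemeasurable hY.aemeasurable).1 h
  have hY' := Measure.isProbabilityMeasure_map (μ := P) hY.aemeasurable
  have h1 : P {ω | (X ω, Y ω) ∈ S} = (P.map fun ω => (X ω, Y ω)) S :=
    (Measure.map_apply (hX.prodMk hY) hS).symm
  rw [h1, hmap, Measure.prod_apply hS, lintegral_map (measurable_measure_prodMk_left hS) hX]
  refine lintegral_congr fun ω => ?_
  rw [Measure.map_apply hY (measurable_prodMk_left hS)]
  rfl

/-- Disjoint subfamilies of an independent family, of any size, are independent. -/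
lemma iIndepFun.indepFun_comp_comp {ι κ κ' : Type*} {β : Type*} [MeasurableSpace β] {G : ι → Ω → β}
    (hG : iIndepFun G P) (hm : ∀ i, Measurable (G i)) (u : κ → ι) (v : κ' → ι)
    (huv : ∀ a b, u a ≠ v b) :
    IndepFun (fun ω a => G (u a) ω) (fun ω b => G (v b) ω) P := by
  refine (IndepFun_iff_Indep _ _ _).2 (indep_of_indep_of_le_left (indep_of_indep_of_le_right
    (indep_iSup_of_disjoint (fun i => (hm i).comap_le) hG.iIndep
      (S := Set.range u) (T := Set.range v) ?_) (comap_subfamily_le G v)) (comap_subfamily_le G u))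
  rw [Set.disjoint_left]
  rintro _ ⟨a, rfl⟩ ⟨b, hb⟩
  exact huv a b hb.symm

/-- The Laplace transform of a countable nonnegative combination of independent exponential
variables. -/
lemma lintegral_expNeg_tsum_exponential {ι : Type*} [Countable ι] {W : ι → Ω → ℝ}
    (hW : iIndepFun W P) (hm : ∀ p, Measurable (W p)) (hlaw : ∀ p, HasLaw (W p) (expMeasure 1) P)
    {t : ι → ℝ} (ht : ∀ p, 0 ≤ t p) :
    ∫⁻ ω, expNeg (∑' p, ENNReal.ofReal (t p * W p ω)) ∂P
      = expNeg (∑' p, ENNReal.ofReal (Real.log (1 + t p))) := by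
  have := hW.isProbabilityMeasure
  have hterm : ∀ p, Measurable fun y => expNeg (ENNReal.ofReal (t p * y)) := fun p => by fun_prop
  have hfin : ∀ s : Finset ι, ∫⁻ ω, expNeg (∑ p ∈ s, ENNReal.ofReal (t p * W p ω)) ∂P
      = expNeg (∑ p ∈ s, ENNReal.ofReal (Real.log (1 + t p))) := by
    intro s
    simp_rw [expNeg_sum]
    have hprod := lintegral_prod_eq_prod_lintegral_of_indepFun s _ (hW.comp _ hterm)
      fun p => (hterm p).comp (hm p)
    simp only [Function.comp_apply] at hprod
    rw [hprod]
    refine Finset.prod_congr rfl fun p _ => ?_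
    rw [(hlaw p).lintegral_comp (hterm p).aemeasurable, lintegral_expNeg_expMeasure_one (ht p)]
  have hL : Tendsto (fun s : Finset ι => ∫⁻ ω, expNeg (∑ p ∈ s, ENNReal.ofReal (t p * W p ω)) ∂P)
      atTop (𝓝 (∫⁻ ω, expNeg (∑' p, ENNReal.ofReal (t p * W p ω)) ∂P)) := by
    refine tendsto_lintegral_filter_of_dominated_convergence (fun _ => 1)
      (Eventually.of_forall fun s => ?_)
      (Eventually.of_forall fun s => ae_of_all _ fun ω => expNeg_le_one _) (by simp)
      (ae_of_all _ fun ω => (continuous_expNeg.tendsto _).comp ENNReal.summable.hasSum)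
    exact measurable_expNeg.comp
      (Finset.measurable_fun_sum s fun p _ => ((hm p).const_mul (t p)).ennreal_ofReal)
  refine tendsto_nhds_unique hL ?_
  simp_rw [hfin]
  exact (continuous_expNeg.tendsto _).comp ENNReal.summable.hasSum

/-- Independent exponential variables exceed all of the independent random levels `Z i` with
probability `E exp (-∑ Z i)`. -/
lemma measure_forall_le_exponential [IsProbabilityMeasure P] {ι : Type*} [Fintype ι] {Y : ι → Ω → ℝ}
    (hY : iIndepFun Y P) (hm : ∀ i, Measurable (Y i)) (hlaw : ∀ i, HasLaw (Y i) (expMeasure 1) P)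
    {Z : Ω → ι → ℝ≥0∞} (hZ : Measurable Z) (hYZ : IndepFun Z (fun ω i => Y i ω) P) :
    P {ω | ∀ i, Z ω i ≤ ENNReal.ofReal (Y i ω)} = ∫⁻ ω, expNeg (∑ i, Z ω i) ∂P := by
  have hS : MeasurableSet {q : (ι → ℝ≥0∞) × (ι → ℝ) | ∀ i, q.1 i ≤ ENNReal.ofReal (q.2 i)} := by
    rw [Set.ofPred_forall]
    exact MeasurableSet.iInter fun i => measurableSet_le (by fun_prop) (by fun_prop)
  have hmain := measure_mem_eq_lintegral_of_indepFun hZ (measurable_pi_lambda _ hm) hYZ hS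
  simp only [Set.mem_ofPred_eq] at hmain
  rw [hmain]
  refine lintegral_congr fun ω => ?_
  have hset : ∀ i, MeasurableSet {y : ℝ | Z ω i ≤ ENNReal.ofReal y} := fun i =>
    measurableSet_le measurable_const (by fun_prop)
  have hint := hY.meas_iInter (s := fun i => {ω' | Z ω i ≤ ENNReal.ofReal (Y i ω')})
    fun i => ⟨_, hset i, rfl⟩
  rw [Set.ofPred_forall, hint, expNeg_sum]
  refine Finset.prod_congr rfl fun i _ => ?_
  rw [(hlaw i).measure_eq (hset i), expMeasure_one_tail]

/-- The success probability for given interferer positions and given UAV interference: `a k` is the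
normalized mean power received from the `k`-th interferer, and `b i` the normalized sum of noise and
UAV interference in slot `i`. -/
lemma measure_forall_add_tsum_le_exponential {M : ℕ} {G : Option ℕ × Fin M → Ω → ℝ}
    (hG : iIndepFun G P) (hm : ∀ p, Measurable (G p)) (hlaw : ∀ p, HasLaw (G p) (expMeasure 1) P)
    {a : ℕ → ℝ} (ha : ∀ k, 0 ≤ a k) (b : Fin M → ℝ≥0∞) :
    P {ω | ∀ i, b i + ∑' k, ENNReal.ofReal (a k * G (some k, i) ω) ≤ ENNReal.ofReal (G (none, i) ω)}
      = expNeg (∑ i, b i) * expNeg (∑' k, ENNReal.ofReal (M * Real.log (1 + a k))) := by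
  have := hG.isProbabilityMeasure
  have hinj : Function.Injective fun i : Fin M => ((none : Option ℕ), i) := fun i j h => by
    simpa using h
  have hinj' : Function.Injective fun p : Fin M × ℕ => (some p.2, p.1) := fun p q h => by
    simp only [Prod.mk.injEq, Option.some.injEq] at h
    exact Prod.ext h.2 h.1
  have hZm : Measurable fun (w : Fin M × ℕ → ℝ) (i : Fin M) =>
      b i + ∑' k, ENNReal.ofReal (a k * w (i, k)) :=
    measurable_pi_lambda _ fun i => measurable_const.add (Measurable.tsum fun k => by fun_prop)
  have hind := ((iIndepFun.indepFun_comp_comp hG hm (fun p : Fin M × ℕ => (some p.2, p.1))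
    (fun i : Fin M => ((none : Option ℕ), i)) (by simp)).comp hZm measurable_id)
  refine (measure_forall_le_exponential (hG.precomp hinj) (fun i => hm _) (fun i => hlaw _)
    (hZm.comp (measurable_pi_lambda _ fun p => hm _)) hind).trans ?_
  have hsum : ∀ f : Fin M × ℕ → ℝ≥0∞, ∑ i, ∑' k, f (i, k) = ∑' p, f p := fun f => by
    rw [ENNReal.tsum_prod', tsum_fintype]
  simp only [Function.comp_apply, Finset.sum_add_distrib, expNeg_add]
  rw [lintegral_const_mul' _ _ (expNeg_ne_top _)]
  congr 1
  have hlap := lintegral_expNeg_tsum_exponential (hG.precomp hinj') (fun p => hm _)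
    (fun p => hlaw _) (t := fun p => a p.2) fun p => ha _
  have hω : ∀ ω, ∑ i, ∑' k, ENNReal.ofReal (a k * G (some k, i) ω)
      = ∑' p : Fin M × ℕ, ENNReal.ofReal (a p.2 * G (some p.2, p.1) ω) := fun ω =>
    hsum fun p => ENNReal.ofReal (a p.2 * G (some p.2, p.1) ω)
  simp_rw [hω]
  rw [hlap, ← hsum fun p => ENNReal.ofReal (Real.log (1 + a p.2))]
  simp [ENNReal.ofReal_mul, ENNReal.tsum_mul_left]

end Fading

/-! ### Integrability of the interference integrand -/

/-- The integrand is bounded by `1`, and by a multiple of `‖x‖ ^ (-α)` with `α > 2`. -/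
lemma integrable_one_sub_inv_one_add_rpow_pow (M : ℕ) {b α d : ℝ} (hb : 0 ≤ b) (hα : 2 < α)
    (hd : 0 ≤ d) :
    Integrable (fun x : Plane => 1 - (1 / (1 + b * ‖x‖ ^ (-α) / d)) ^ M) volume := by
  have hint : Integrable (fun x : Plane => 2 ^ α * (1 + M * (b / d)) * (1 + ‖x‖) ^ (-α)) volume :=
    (integrable_one_add_norm (by simpa using hα)).const_mul _
  refine hint.mono' (Measurable.aestronglyMeasurable (by fun_prop)) (ae_of_all _ fun x => ?_)
  set t : ℝ := b * ‖x‖ ^ (-α) / d with ht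
  have ht0 : 0 ≤ t := by positivity
  have hinv : 0 ≤ 1 / (1 + t) := by positivity
  have hinv1 : 1 / (1 + t) ≤ 1 := by
    rw [div_le_one (by linarith)]
    linarith
  have hpow1 : (1 / (1 + t)) ^ M ≤ 1 := pow_le_one₀ hinv hinv1
  have hpow0 : 0 ≤ (1 / (1 + t)) ^ M := pow_nonneg hinv M
  have hbern : 1 - (1 / (1 + t)) ^ M ≤ M * t := by
    have h1 := one_add_mul_le_pow (a := 1 / (1 + t) - 1) (by linarith) M
    have h2 : 1 / (1 + t) - 1 ≥ -t := by
      rw [ge_iff_le, le_sub_iff_add_le, le_div_iff₀ (by linarith)]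
      nlinarith
    have h3 : (M : ℝ) * -t ≤ M * (1 / (1 + t) - 1) := by gcongr
    rw [add_sub_cancel] at h1
    linarith
  have hx0 : 0 ≤ ‖x‖ := norm_nonneg x
  have h2α : (0 : ℝ) < 2 ^ α := by positivity
  have hJ : 0 < (1 + ‖x‖) ^ (-α) := by positivity
  have hMb : 0 ≤ (M : ℝ) * (b / d) := by positivity
  -- Halving `1 + ‖x‖` turns the two bounds into bounds by `(1 + ‖x‖) ^ (-α)`.
  have hhalf : ((1 + ‖x‖) / 2) ^ (-α) = 2 ^ α * (1 + ‖x‖) ^ (-α) := by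
    rw [Real.div_rpow (by positivity) (by norm_num), Real.rpow_neg (by norm_num : (0 : ℝ) ≤ 2),
      div_inv_eq_mul, mul_comm]
  rw [Real.norm_of_nonneg (by linarith)]
  rcases le_or_gt ‖x‖ 1 with h | h
  · have h1 : (1 : ℝ) ≤ ((1 + ‖x‖) / 2) ^ (-α) :=
      Real.one_le_rpow_of_pos_of_le_one_of_nonpos (by positivity) (by linarith) (by linarith)
    rw [hhalf] at h1
    nlinarith [mul_nonneg hMb (mul_pos h2α hJ).le]
  · have h1 : ‖x‖ ^ (-α) ≤ ((1 + ‖x‖) / 2) ^ (-α) :=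
      Real.rpow_le_rpow_of_nonpos (by positivity) (by linarith) (by linarith)
    rw [hhalf] at h1
    have h2 : (M : ℝ) * t ≤ M * (b / d) * (2 ^ α * (1 + ‖x‖) ^ (-α)) := by
      have : (M : ℝ) * t = M * (b / d) * ‖x‖ ^ (-α) := by rw [ht]; ring
      rw [this]
      gcongr
    nlinarith [mul_pos h2α hJ]

/-! ### Outage probability of the network -/

namespace RandomNetwork

variable {M : ℕ} {θ : NetworkParams M} {Ω : Type*} [MeasurableSpace Ω] {P : Measure Ω}
  (net : RandomNetwork θ P)

/-- The UAV interference in slot `i` as a function of the line-of-sight indicator. -/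
noncomputable def uavPower (θ : NetworkParams M) (i : Fin M) (l : Bool) : ℝ :=
  if l = true then θ.Pu * θ.uavDist i ^ (-θ.αu) else θ.η * θ.Pu * θ.uavDist i ^ (-θ.αu)

lemma uavDist_pos (θ : NetworkParams M) (i : Fin M) : 0 < θ.uavDist i := by
  have := θ.alt_pos i
  unfold NetworkParams.uavDist
  positivity

lemma uavPower_pos (θ : NetworkParams M) (i : Fin M) (l : Bool) : 0 < uavPower θ i l := by
  have := uavDist_pos θ i
  have := θ.Pu_pos
  have := θ.η_pos
  unfold uavPower
  split_ifs <;> positivity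

/-- The mean power received from an interferer at `x`, normalized so that it is compared with
the gain of the selected link. At `x = θ.rx` the power is the junk value `0 ^ (-αd) = 0`, which does
not matter since the receiver is a null set. -/
noncomputable def interfererLoad (θ : NetworkParams M) (x : Plane) : ℝ :=
  θ.β * ‖x - θ.rx‖ ^ (-θ.αd) / θ.d₀ ^ (-θ.αd)

lemma interfererLoad_nonneg (θ : NetworkParams M) (x : Plane) : 0 ≤ interfererLoad θ x := by
  have := θ.β_pos
  have := θ.d₀_pos
  unfold interfererLoad
  positivity

@[fun_prop]
lemma measurable_interfererLoad (θ : NetworkParams M) : Measurable (interfererLoad θ) := by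
  unfold interfererLoad
  fun_prop

/-- The UAV interference and the noise in slot `i`, normalized as in `interfererLoad`. -/
noncomputable def slotLoad (θ : NetworkParams M) (i : Fin M) (l : Bool) : ℝ :=
  θ.d₀ ^ θ.αd * θ.β / θ.Pd * (uavPower θ i l + θ.N)

lemma slotLoad_nonneg (θ : NetworkParams M) (i : Fin M) (l : Bool) : 0 ≤ slotLoad θ i l := by
  have := θ.β_pos
  have := θ.d₀_pos
  have := θ.Pd_pos
  have := θ.N_nonneg
  have := uavPower_pos θ i l
  unfold slotLoad
  positivity

/-- A transmission succeeds when the gain of the selected link exceeds the total load. -/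
lemma le_sinr_iff (i : Fin M) (ω : Ω) :
    ENNReal.ofReal θ.β ≤ net.sinr i ω ↔
      ENNReal.ofReal (slotLoad θ i (net.los i ω))
        + ∑' k, ENNReal.ofReal (interfererLoad θ (net.pos k ω) * net.gain (some k) i ω)
        ≤ ENNReal.ofReal (net.gain none i ω) := by
  have hβ := θ.β_pos
  have hd := θ.d₀_pos
  have hP := θ.Pd_pos
  have hN := θ.N_nonneg
  have hU : 0 < net.uavInterference i ω := uavPower_pos θ i (net.los i ω)
  have hc : 0 < θ.Pd * θ.d₀ ^ (-θ.αd) := by positivity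
  have hneg : θ.d₀ ^ (-θ.αd) = (θ.d₀ ^ θ.αd)⁻¹ := Real.rpow_neg hd.le _
  have hdα : 0 < θ.d₀ ^ θ.αd := by positivity
  have hbne : ENNReal.ofReal (net.uavInterference i ω) ≠ 0 := by simpa using hU
  rw [sinr, ENNReal.le_div_iff_mul_le (Or.inl (by simp [hbne])) (Or.inr ENNReal.ofReal_ne_top)]
  -- Both sides of the right-hand inequality are multiplied by the mean received signal power.
  rw [← ENNReal.mul_le_mul_iff_right (a := ENNReal.ofReal (θ.Pd * θ.d₀ ^ (-θ.αd)))
    (b := ENNReal.ofReal (slotLoad θ i (net.los i ω)) + _) (by simpa using hc)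
    ENNReal.ofReal_ne_top, ← ENNReal.ofReal_mul hc.le]
  have hslot : θ.Pd * θ.d₀ ^ (-θ.αd) * slotLoad θ i (net.los i ω)
      = θ.β * (net.uavInterference i ω + θ.N) := by
    rw [slotLoad, hneg]
    change _ = θ.β * (uavPower θ i (net.los i ω) + θ.N)
    field_simp
  have hint : ∀ k, θ.Pd * θ.d₀ ^ (-θ.αd) *
      (interfererLoad θ (net.pos k ω) * net.gain (some k) i ω)
      = θ.β * (θ.Pd * ‖net.pos k ω - θ.rx‖ ^ (-θ.αd) * net.gain (some k) i ω) := by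
    intro k
    rw [interfererLoad]
    field_simp
  have hload : ENNReal.ofReal (θ.Pd * θ.d₀ ^ (-θ.αd))
      * (ENNReal.ofReal (slotLoad θ i (net.los i ω))
        + ∑' k, ENNReal.ofReal (interfererLoad θ (net.pos k ω) * net.gain (some k) i ω))
      = ENNReal.ofReal θ.β * (net.d2dInterference i ω
        + ENNReal.ofReal (net.uavInterference i ω) + ENNReal.ofReal θ.N) := by
    rw [mul_add, ← ENNReal.tsum_mul_left, ← ENNReal.ofReal_mul hc.le, hslot]
    simp_rw [← ENNReal.ofReal_mul hc.le, hint, ENNReal.ofReal_mul hβ.le]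
    rw [ENNReal.tsum_mul_left, ← mul_add, ENNReal.ofReal_add hU.le hN, d2dInterference]
    ring
  rw [hload, signal]

/-- The probability of success in all slots, before the point process and the line-of-sight
indicators are averaged out. -/
lemma measure_success_eq [IsProbabilityMeasure P] :
    P {ω | ∀ i, ENNReal.ofReal θ.β ≤ net.sinr i ω}
      = (∫⁻ ω, expNeg (∑ i, ENNReal.ofReal (slotLoad θ i (net.los i ω))) ∂P)
        * ∫⁻ ω, expNeg (∑' k, ENNReal.ofReal
            (M * Real.log (1 + interfererLoad θ (net.pos k ω)))) ∂P := by
  let S : Set ((Fin M → Bool) × (ℕ → Plane) × (Option ℕ × Fin M → ℝ)) := {q | ∀ i,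
    ENNReal.ofReal (slotLoad θ i (q.1 i))
      + ∑' k, ENNReal.ofReal (interfererLoad θ (q.2.1 k) * q.2.2 (some k, i))
      ≤ ENNReal.ofReal (q.2.2 (none, i))}
  have hS : MeasurableSet S := by
    simp only [S, Set.ofPred_forall]
    refine MeasurableSet.iInter fun i => measurableSet_le (Measurable.fun_add ?_ ?_) (by fun_prop)
    · exact (Measurable.of_discrete (f := fun l => ENNReal.ofReal (slotLoad θ i l))).comp
        ((measurable_pi_apply i).comp measurable_fst)
    · exact Measurable.tsum fun k => by fun_prop
  have hpos : Measurable fun ω (k : ℕ) => net.pos k ω :=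
    measurable_pi_lambda _ net.poisson_pos.measurable_point
  have hgain : Measurable fun ω (p : Option ℕ × Fin M) => net.gain p.1 p.2 ω :=
    measurable_pi_lambda _ fun p => net.measurable_gain p.1 p.2
  have hlos : Measurable fun ω (i : Fin M) => net.los i ω :=
    measurable_pi_lambda _ net.measurable_los
  have hset : {ω | ∀ i, ENNReal.ofReal θ.β ≤ net.sinr i ω}
      = {ω | ((fun i => net.los i ω), (fun k => net.pos k ω),
          fun p : Option ℕ × Fin M => net.gain p.1 p.2 ω) ∈ S} := by
    ext ω
    exact forall_congr' fun i => net.le_sinr_iff i ω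
  rw [hset, measure_mem_eq_lintegral_of_indepFun hlos (hpos.prodMk hgain)
    net.indep_ground_los.symm hS]
  have hcond : ∀ l : Fin M → Bool, P {ω | (l, (fun k => net.pos k ω),
          fun p : Option ℕ × Fin M => net.gain p.1 p.2 ω) ∈ S}
      = expNeg (∑ i, ENNReal.ofReal (slotLoad θ i (l i))) *
        ∫⁻ ω, expNeg (∑' k, ENNReal.ofReal
            (M * Real.log (1 + interfererLoad θ (net.pos k ω)))) ∂P := by
    intro l
    have h := measure_mem_eq_lintegral_of_indepFun hpos hgain net.indep_pos_gain
      (measurable_prodMk_left (x := l) hS)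
    refine h.trans ?_
    rw [← lintegral_const_mul' _ _ (expNeg_ne_top _)]
    exact lintegral_congr fun ω => measure_forall_add_tsum_le_exponential net.iIndep_gain
      (fun p => net.measurable_gain p.1 p.2) (fun p => net.hasLaw_gain p.1 p.2)
      (fun k => interfererLoad_nonneg θ (net.pos k ω))
      fun i => ENNReal.ofReal (slotLoad θ i (l i))
  simp_rw [hcond]
  refine lintegral_mul_const _ (measurable_expNeg.comp (Finset.measurable_fun_sum _ fun i _ => ?_))
  exact (Measurable.of_discrete (f := fun l => ENNReal.ofReal (slotLoad θ i l))).comp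
    (net.measurable_los i)

lemma measurable_exp_uavInterference (c : ℝ) (i : Fin M) :
    Measurable fun ω => Real.exp (c * net.uavInterference i ω / θ.Pd) :=
  (Measurable.of_discrete (f := fun l => Real.exp (c * uavPower θ i l / θ.Pd))).comp
    (net.measurable_los i)

/-- The line-of-sight indicators are independent, so their contribution is a product over slots. -/
lemma lintegral_expNeg_slotLoad [IsProbabilityMeasure P] :
    ∫⁻ ω, expNeg (∑ i, ENNReal.ofReal (slotLoad θ i (net.los i ω))) ∂P
      = ENNReal.ofReal ((∏ i : Fin M,
          ∫ ω, Real.exp (-θ.d₀ ^ θ.αd * θ.β * net.uavInterference i ω / θ.Pd) ∂P)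
          * Real.exp (-θ.d₀ ^ θ.αd * θ.β * (M : ℝ) * θ.N / θ.Pd)) := by
  have hP := θ.Pd_pos
  simp_rw [expNeg_sum]
  have hprod := lintegral_prod_eq_prod_lintegral_of_indepFun Finset.univ _
    (net.iIndep_los.comp (fun i l => expNeg (ENNReal.ofReal (slotLoad θ i l)))
      fun i => Measurable.of_discrete)
    fun i => Measurable.of_discrete.comp (net.measurable_los i)
  simp only [Function.comp_apply] at hprod
  have hslot : ∀ i, ∫⁻ ω, expNeg (ENNReal.ofReal (slotLoad θ i (net.los i ω))) ∂P
      = ENNReal.ofReal ((∫ ω, Real.exp (-θ.d₀ ^ θ.αd * θ.β * net.uavInterference i ω / θ.Pd) ∂P)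
        * Real.exp (-θ.d₀ ^ θ.αd * θ.β * θ.N / θ.Pd)) := by
    intro i
    have hmeas := net.measurable_exp_uavInterference (-θ.d₀ ^ θ.αd * θ.β) i
    rw [ENNReal.ofReal_mul (integral_nonneg fun ω => (Real.exp_pos _).le),
      integral_eq_lintegral_of_nonneg_ae (ae_of_all _ fun ω => (Real.exp_pos _).le)
        hmeas.aestronglyMeasurable]
    have heq : ∀ ω, expNeg (ENNReal.ofReal (slotLoad θ i (net.los i ω)))
        = ENNReal.ofReal (Real.exp (-θ.d₀ ^ θ.αd * θ.β * net.uavInterference i ω / θ.Pd))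
          * ENNReal.ofReal (Real.exp (-θ.d₀ ^ θ.αd * θ.β * θ.N / θ.Pd)) := by
      intro ω
      rw [expNeg_ofReal (slotLoad_nonneg _ _ _), ← ENNReal.ofReal_mul (Real.exp_pos _).le,
        ← Real.exp_add]
      change ENNReal.ofReal (Real.exp (-slotLoad θ i (net.los i ω))) = ENNReal.ofReal (Real.exp
        (-θ.d₀ ^ θ.αd * θ.β * uavPower θ i (net.los i ω) / θ.Pd + _))
      rw [slotLoad]
      congr 2
      ring
    simp_rw [heq]
    rw [lintegral_mul_const _ hmeas.ennreal_ofReal, ENNReal.ofReal_toReal]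
    refine ne_top_of_le_ne_top (measure_ne_top P Set.univ) ?_
    rw [← lintegral_one]
    refine lintegral_mono fun ω => ?_
    have hU : 0 < net.uavInterference i ω := uavPower_pos θ i (net.los i ω)
    have hβ := θ.β_pos
    have hd := θ.d₀_pos
    rw [← ENNReal.ofReal_one]
    refine ENNReal.ofReal_le_ofReal (Real.exp_le_one_iff.2 ?_)
    have : 0 ≤ θ.d₀ ^ θ.αd * θ.β * net.uavInterference i ω / θ.Pd := by positivity
    simpa only [neg_mul, neg_div, Left.neg_nonpos_iff] using this
  rw [hprod, Finset.prod_congr rfl fun i _ => hslot i, ← ENNReal.ofReal_prod_of_nonneg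
    fun i _ => mul_nonneg (integral_nonneg fun ω => (Real.exp_pos _).le) (Real.exp_pos _).le,
    Finset.prod_mul_distrib, Finset.prod_const, Finset.card_univ, Fintype.card_fin,
    ← Real.exp_nat_mul]
  congr 3
  ring

/-- The contribution of the interferers, given by the Laplace functional of the Poisson process. -/
lemma lintegral_expNeg_interfererLoad [IsProbabilityMeasure P] :
    ∫⁻ ω, expNeg (∑' k, ENNReal.ofReal (M * Real.log (1 + interfererLoad θ (net.pos k ω)))) ∂P
      = ENNReal.ofReal (Real.exp (-θ.lam * ∫ x : Plane,
            (1 - (1 / (1 + θ.β * ‖x‖ ^ (-θ.αd) / θ.d₀ ^ (-θ.αd))) ^ M))) := by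
  have hd := θ.d₀_pos
  have hlam := θ.lam_pos
  set F : Plane → ℝ := fun x => 1 - (1 / (1 + θ.β * ‖x‖ ^ (-θ.αd) / θ.d₀ ^ (-θ.αd))) ^ M with hF
  have hint : Integrable F volume := integrable_one_sub_inv_one_add_rpow_pow M θ.β_pos.le
    θ.two_lt_αd (Real.rpow_nonneg hd.le _)
  have hterm : ∀ x, 1 - expNeg (ENNReal.ofReal (M * Real.log (1 + interfererLoad θ x)))
      = ENNReal.ofReal (F (x - θ.rx)) := by
    intro x
    have h0 := interfererLoad_nonneg θ x
    have h1 : 0 ≤ Real.log (1 + interfererLoad θ x) := Real.log_nonneg (by linarith)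
    rw [expNeg_ofReal (by positivity), ← ENNReal.ofReal_one, ← ENNReal.ofReal_sub _ (by positivity),
      ← mul_neg, Real.exp_nat_mul, Real.exp_neg, Real.exp_log (by linarith), ← one_div]
    rfl
  have hF0 : ∀ x, 0 ≤ F x := by
    intro x
    have hβ := θ.β_pos
    have h0 : 0 ≤ θ.β * ‖x‖ ^ (-θ.αd) / θ.d₀ ^ (-θ.αd) := by positivity
    refine sub_nonneg.2 (pow_le_one₀ (by positivity) ?_)
    rw [div_le_one (by linarith)]
    linarith
  have : SigmaFinite (ENNReal.ofReal θ.lam • (volume : Measure Plane)) :=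
    inferInstanceAs (SigmaFinite (θ.lam.toNNReal • (volume : Measure Plane)))
  rw [net.poisson_pos.lintegral_expNeg_tsum
    (f := fun x => ENNReal.ofReal (M * Real.log (1 + interfererLoad θ x))) (by fun_prop)]
  simp_rw [hterm]
  rw [lintegral_smul_measure, lintegral_sub_right_eq_self fun x => ENNReal.ofReal (F x),
    ← ofReal_integral_eq_lintegral_ofReal hint (ae_of_all _ hF0), smul_eq_mul,
    ← ENNReal.ofReal_mul hlam.le, expNeg_ofReal (mul_nonneg hlam.le (integral_nonneg hF0)), neg_mul]

lemma integral_exp_uavInterference [IsProbabilityMeasure P] (i : Fin M) :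
    ∫ ω, Real.exp (-θ.d₀ ^ θ.αd * θ.β * net.uavInterference i ω / θ.Pd) ∂P =
        θ.probLoS i
            * Real.exp (-θ.β * θ.d₀ ^ θ.αd * θ.Pu * θ.uavDist i ^ (-θ.αu) / θ.Pd)
          + θ.probNLoS i
            * Real.exp (-θ.β * θ.d₀ ^ θ.αd * θ.η * θ.Pu * θ.uavDist i ^ (-θ.αu) / θ.Pd) := by
  have hS : MeasurableSet {ω | net.los i ω = true} :=
    net.measurable_los i (measurableSet_singleton true)
  have hp : P.real {ω | net.los i ω = true} = θ.probLoS i := by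
    have hC := θ.C_pos
    rw [measureReal_def, net.prob_los i, ENNReal.toReal_ofReal]
    unfold NetworkParams.probLoS
    positivity
  set A := Real.exp (-θ.β * θ.d₀ ^ θ.αd * θ.Pu * θ.uavDist i ^ (-θ.αu) / θ.Pd) with hA
  set B := Real.exp (-θ.β * θ.d₀ ^ θ.αd * θ.η * θ.Pu * θ.uavDist i ^ (-θ.αu) / θ.Pd) with hB
  have hpt : ∀ ω, Real.exp (-θ.d₀ ^ θ.αd * θ.β * net.uavInterference i ω / θ.Pd)
      = {ω | net.los i ω = true}.indicator (fun _ => A) ω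
        + {ω | net.los i ω = true}ᶜ.indicator (fun _ => B) ω := by
    intro ω
    rw [uavInterference]
    by_cases h : net.los i ω = true
    · rw [Set.indicator_of_mem (by exact h), Set.indicator_of_notMem (by simp [h]), if_pos h,
        add_zero, hA]
      congr 1
      ring
    · rw [Set.indicator_of_notMem (by exact h), Set.indicator_of_mem (by exact h), if_neg h,
        zero_add, hB]
      congr 1
      ring
  simp_rw [hpt]
  rw [integral_add ((integrable_const A).indicator hS) ((integrable_const B).indicator hS.compl),
    integral_indicator_const _ hS, integral_indicator_const _ hS.compl,
    probReal_compl_eq_one_sub hS, hp, NetworkParams.probNLoS, smul_eq_mul, smul_eq_mul]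

lemma measurable_sinr (i : Fin M) : Measurable (net.sinr i) := by
  have h1 : Measurable (net.d2dInterference i) := Measurable.tsum fun k =>
    ((((net.poisson_pos.measurable_point k).sub_const _).norm.pow_const _).const_mul _
      |>.mul (net.measurable_gain _ _)).ennreal_ofReal
  have h2 : Measurable (net.uavInterference i) :=
    (Measurable.of_discrete (f := uavPower θ i)).comp (net.measurable_los i)
  exact ((net.measurable_gain none i).const_mul _).ennreal_ofReal.div
    ((h1.add h2.ennreal_ofReal).add_const _)

lemma outageProb_eq [IsProbabilityMeasure P] :
    net.outageProb = 1 - P.real {ω | ∀ i, ENNReal.ofReal θ.β ≤ net.sinr i ω} := by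
  have hS : MeasurableSet {ω | ∀ i, ENNReal.ofReal θ.β ≤ net.sinr i ω} := by
    rw [Set.ofPred_forall]
    exact MeasurableSet.iInter fun i => measurableSet_le measurable_const (net.measurable_sinr i)
  rw [outageProb, ← probReal_compl_eq_one_sub hS]
  congr 1
  ext ω
  simp

end RandomNetwork

theorem theorem3 {M : ℕ} (θ : NetworkParams M) {Ω : Type*} [MeasurableSpace Ω] (P : Measure Ω)
    [IsProbabilityMeasure P] (net : RandomNetwork θ P) :
    Integrable (fun x : Plane =>
        1 - (1 / (1 + θ.β * ‖x‖ ^ (-θ.αd) / θ.d₀ ^ (-θ.αd))) ^ M) volume ∧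
    net.outageProb =
      1 - Real.exp (-θ.lam * ∫ x : Plane,
            (1 - (1 / (1 + θ.β * ‖x‖ ^ (-θ.αd) / θ.d₀ ^ (-θ.αd))) ^ M))
          * (∏ i : Fin M,
              ∫ ω, Real.exp (-θ.d₀ ^ θ.αd * θ.β * net.uavInterference i ω / θ.Pd) ∂P)
          * Real.exp (-θ.d₀ ^ θ.αd * θ.β * (M : ℝ) * θ.N / θ.Pd) ∧
    ∀ i : Fin M,
      ∫ ω, Real.exp (-θ.d₀ ^ θ.αd * θ.β * net.uavInterference i ω / θ.Pd) ∂P =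
        θ.probLoS i
            * Real.exp (-θ.β * θ.d₀ ^ θ.αd * θ.Pu * θ.uavDist i ^ (-θ.αu) / θ.Pd)
          + θ.probNLoS i
            * Real.exp (-θ.β * θ.d₀ ^ θ.αd * θ.η * θ.Pu * θ.uavDist i ^ (-θ.αu) / θ.Pd) := by
  refine ⟨integrable_one_sub_inv_one_add_rpow_pow M θ.β_pos.le θ.two_lt_αd
    (Real.rpow_nonneg θ.d₀_pos.le _), ?_, net.integral_exp_uavInterference⟩
  have hnonneg : 0 ≤ (∏ i : Fin M,
      ∫ ω, Real.exp (-θ.d₀ ^ θ.αd * θ.β * net.uavInterference i ω / θ.Pd) ∂P)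
      * Real.exp (-θ.d₀ ^ θ.αd * θ.β * (M : ℝ) * θ.N / θ.Pd) :=
    mul_nonneg (Finset.prod_nonneg fun i _ => integral_nonneg fun ω => (Real.exp_pos _).le)
      (Real.exp_pos _).le
  rw [net.outageProb_eq, measureReal_def, net.measure_success_eq, net.lintegral_expNeg_slotLoad,
    net.lintegral_expNeg_interfererLoad, ENNReal.toReal_mul, ENNReal.toReal_ofReal hnonneg,
    ENNReal.toReal_ofReal (Real.exp_pos _).le]
  ring
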